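/- Let $\mu$ be a finite positive Borel measure on $\mathbb{C}$ whose closed support is compact and infinite. Let $P$ be the orthogonal projection of $L^2(\mu)$ onto the closure $P^2(\mu)$ of the complex polynomials in $L^2(\mu)$, and let $M$ be the operator of multiplication by $z$ on $L^2(\mu)$. Let $p_0, p_1, p_2, \dots$ be the orthonormal polynomials of $\mu$ (so $\deg p_n = n$, the leading coefficient of $p_n$ is positive, and $\int p_j \overline{p_k}\, d\mu = \delta_{jk}$), and for $n \ge 0$ let $$K_n(z,w) = \sum_{j=0}^{n} p_j(z)\,\overline{p_j(w)}$$ be the Christoffel–Darboux kernels. Then the Hankel operator $T = (I-P)M^*P$ on $L^2(\mu)$ is Hilbert–Schmidt; there is a unique $L \in L^2(\mu\otimes\mu)$ such that, for every $f \in L^2(\mu)$, $$(Tf)(z) = \int L(z,w) f(w)\, d\mu(w) \quad \text{for } \mu\text{-almost every } z;$$ and the functions $\overline{z}\, K_{n+1}(z,w) - \overline{w}\, K_n(z,w)$ belong to $L^2(\mu\otimes\mu)$ and satisfy $$\lim_{n\to\infty} \left[\, \overline{z}\, K_{n+1}(z,w) - \overline{w}\, K_n(z,w) \,\right] = L(z,w)$$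 in the weak topology of $L^2(\mu\otimes\mu)$. -/

import Mathlib

open MeasureTheory Filter Topology Polynomial ComplexConjugate
open scoped ENNReal

noncomputable section

/-- A finite measure on `ℂ` with compact support is carried by a bounded set, so the coordinate
function `z` is essentially bounded. -/
theorem memLp_top_coord (μ : Measure ℂ) (hμ : IsCompact μ.support) :
    MemLp (fun z : ℂ => z) ∞ μ := by
  obtain ⟨C, hC⟩ := hμ.isBounded.exists_norm_le
  refine memLp_top_of_bound measurable_id.aestronglyMeasurable C ?_
  filter_upwards [μ.support_mem_ae] with z hz using hC z hz

/-- The operator `M` of multiplication by the coordinate `z` on `L²(μ)`, for a measure `μ` with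
compact support. -/
def mulCoord (μ : Measure ℂ) (hμ : IsCompact μ.support) : Lp ℂ 2 μ →L[ℂ] Lp ℂ 2 μ :=
  (ContinuousLinearMap.mul ℂ ℂ).holderL μ ∞ 2 2 (memLp_top_coord μ hμ).toLp

/-- The classes in `L²(μ)` of the complex polynomials in one variable. -/
def polySubspace (μ : Measure ℂ) : Submodule ℂ (Lp ℂ 2 μ) where
  carrier := {f | ∃ p : ℂ[X], (f : ℂ → ℂ) =ᵐ[μ] fun z => p.eval z}
  add_mem' := by
    rintro f g ⟨p, hp⟩ ⟨q, hq⟩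
    refine ⟨p + q, ?_⟩
    refine (Lp.coeFn_add f g).trans ?_
    filter_upwards [hp, hq] with z h2 h3
    simp [h2, h3]
  zero_mem' := by
    refine ⟨0, ?_⟩
    refine (Lp.coeFn_zero ℂ 2 μ).trans ?_
    filter_upwards with z
    simp
  smul_mem' := by
    rintro c f ⟨p, hp⟩
    refine ⟨c • p, ?_⟩
    refine (Lp.coeFn_smul c f).trans ?_
    filter_upwards [hp] with z h2
    simp [h2]

/-- `P²(μ)`: the closure of the complex polynomials in `L²(μ)`. -/
def polyClosure (μ : Measure ℂ) : Submodule ℂ (Lp ℂ 2 μ) :=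
  (polySubspace μ).topologicalClosure

instance (μ : Measure ℂ) : CompleteSpace (polyClosure μ) :=
  Submodule.topologicalClosure.completeSpace (polySubspace μ)

/-- The orthogonal projection `P` of `L²(μ)` onto `P²(μ)`. -/
def polyProj (μ : Measure ℂ) : Lp ℂ 2 μ →L[ℂ] Lp ℂ 2 μ :=
  (polyClosure μ).starProjection

/-- The Hankel operator `(I - P) M* P`, as an operator on `L²(μ)`. -/
def hankelOp (μ : Measure ℂ) (hμ : IsCompact μ.support) : Lp ℂ 2 μ →L[ℂ] Lp ℂ 2 μ :=
  (ContinuousLinearMap.id ℂ (Lp ℂ 2 μ) - polyProj μ) ∘L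
    (ContinuousLinearMap.adjoint (mulCoord μ hμ)) ∘L polyProj μ

/-- A bounded operator is Hilbert–Schmidt if the squared norms of the images of the members of an
orthonormal basis are summable, whatever the basis. -/
def IsHilbertSchmidt {H : Type*} [NormedAddCommGroup H] [InnerProductSpace ℂ H]
    (A : H →L[ℂ] H) : Prop :=
  ∀ (s : Set H) (b : HilbertBasis s ℂ H), Summable fun i => ‖A (b i)‖ ^ 2

/-- `L ∈ L²(μ ⊗ μ)` is an integral kernel of the operator `A` on `L²(μ)`:
`(A f)(z) = ∫ L(z, w) f(w) dμ(w)` for every `f ∈ L²(μ)` and almost every `z`. -/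
def IsIntegralKernel (μ : Measure ℂ) (L : Lp ℂ 2 (μ.prod μ)) (A : Lp ℂ 2 μ →L[ℂ] Lp ℂ 2 μ) :
    Prop :=
  ∀ f : Lp ℂ 2 μ, (A f : ℂ → ℂ) =ᵐ[μ] fun z => ∫ w, L (z, w) * f w ∂μ

/-- The inner product `⟨p, q⟩ = ∫ p q̄ dμ` of two polynomials. -/
def polyInner (μ : Measure ℂ) (p q : ℂ[X]) : ℂ :=
  ∫ z, p.eval z * conj (q.eval z) ∂μ

/-- The monic orthogonal polynomial of degree `n`, by the Gram–Schmidt process applied to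
`1, z, z², …`. -/
def monicOrthoPoly (μ : Measure ℂ) (n : ℕ) : ℂ[X] :=
  X ^ n - ∑ j : Fin n,
    C (polyInner μ (X ^ n) (monicOrthoPoly μ j) /
      polyInner μ (monicOrthoPoly μ j) (monicOrthoPoly μ j)) * monicOrthoPoly μ j
termination_by n
decreasing_by all_goals exact j.2

/-- The orthonormal polynomial `p_n` of degree `n`, with positive leading coefficient. -/
def orthoPoly (μ : Measure ℂ) (n : ℕ) : ℂ[X] :=
  C (((√(∫ z, ‖(monicOrthoPoly μ n).eval z‖ ^ 2 ∂μ))⁻¹ : ℝ) : ℂ) * monicOrthoPoly μ n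

/-- The Christoffel–Darboux kernel `K_n(z, w) = ∑_{j = 0}^{n} p_j(z) conj(p_j(w))`. -/
def cdKernel (μ : Measure ℂ) (n : ℕ) (z w : ℂ) : ℂ :=
  ∑ j ∈ Finset.range (n + 1), (orthoPoly μ j).eval z * conj ((orthoPoly μ j).eval w)

/-- The function `z̄ K_{n+1}(z, w) - w̄ K_n(z, w)` on `ℂ × ℂ`. -/
def approxKernel (μ : Measure ℂ) (n : ℕ) (x : ℂ × ℂ) : ℂ :=
  conj x.1 * cdKernel μ (n + 1) x.1 x.2 - conj x.2 * cdKernel μ n x.1 x.2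

end

/-!
Let `e_j` be the class of the orthonormal polynomial `p_j`, let `P_n` be the projection onto the
span of `e_0, …, e_n`, and write `T` for the Hankel operator.

The functions `z̄ K_{n+1}(z, w) - w̄ K_n(z, w)` are the integral kernels of `M* P_{n+1} - P_n M*`.
As `n` grows, these operators converge strongly to `M* P - P M*`. Since `P²(μ)` is invariant under
`M`, its orthogonal complement is invariant under `M*`, so the limit is `T`
(`hankelOp_eq_commutator`). Hence the kernels converge to the kernel `L` of `T` when tested against
the elementary tensors `(z, w) ↦ g z * conj (f w)`. These span a dense subspace of `L²(μ ⊗ μ)`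
(`eq_zero_of_forall_inner_tensorConj`), which also gives the uniqueness of `L`. For weak convergence
it remains to bound the `L²` norms of the kernels, that is, the Hilbert–Schmidt norms of the
operators.

`M` raises the degree by one, so `M* P_{n+1} - P_n M* = (I - P_n) M* P_{n+1}`, and the kernel is the
orthogonal sum of the tensors of `(I - P_n) M* e_i` and `e_i` for `i ≤ n + 1`. The estimate is the
finite-dimensional core of the Berger–Shaw theorem
(`sum_norm_sq_orthoRemainder_adjoint_le`): because `M` is normal, `‖M* e_i‖ = ‖M e_i‖`, so
`∑_{i ≤ n} ‖(I - P_n) M* e_i‖²` equals the sum of `|⟪e_j, M e_i⟫|²` over `i ≤ n`, `j ≤ n + 1`, less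
the sum over `i, j ≤ n`. What remains is the row `j = n + 1`, which is at most `‖M‖²` by Bessel's
inequality. The term `i = n + 1` adds at most `‖M‖²` more.

The same estimate gives `∑ ‖T e_j‖² ≤ ‖M‖²`, because `‖T e_j‖ ≤ ‖(I - P_n) M* e_j‖` for every `n`.
As `T` vanishes on the orthogonal complement of the `e_j`, it is Hilbert–Schmidt
(`isHilbertSchmidt_of_summable`), and `L(z, w) = ∑ (T p_j)(z) conj (p_j(w))` is an orthogonal
series converging in `L²(μ ⊗ μ)`.
-/

/-! ### The trace estimate for a Hessenberg matrix -/

section Hilbert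

variable {H : Type*} [NormedAddCommGroup H] [InnerProductSpace ℂ H]

/-- The part of `x` orthogonal to `e 0, …, e n`. -/
noncomputable def orthoRemainder (e : ℕ → H) (n : ℕ) (x : H) : H :=
  x - ∑ j ∈ Finset.range (n + 1), inner ℂ (e j) x • e j

theorem inner_orthoRemainder {e : ℕ → H} (he : Orthonormal ℂ e) {n j : ℕ} (hj : j ≤ n) (x : H) :
    inner ℂ (e j) (orthoRemainder e n x) = 0 := by
  rw [orthoRemainder, inner_sub_right, he.inner_right_sum _ (by simp; omega), sub_self]

theorem norm_sq_orthoRemainder {e : ℕ → H} (he : Orthonormal ℂ e) (n : ℕ) (x : H) :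
    ‖orthoRemainder e n x‖ ^ 2 =
      ‖x‖ ^ 2 - ∑ j ∈ Finset.range (n + 1), ‖inner ℂ (e j) x‖ ^ 2 := by
  have hp : ∑ j ∈ Finset.range (n + 1), ‖inner ℂ (e j) x‖ ^ 2 =
      ‖∑ j ∈ Finset.range (n + 1), inner ℂ (e j) x • e j‖ ^ 2 := by
    have h := he.inner_sum (fun j => inner ℂ (e j) x) (fun j => inner ℂ (e j) x)
      (Finset.range (n + 1))
    rw [inner_self_eq_norm_sq_to_K] at h
    have h2 : ∀ j, conj (inner ℂ (e j) x) * inner ℂ (e j) x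
        = ((‖inner ℂ (e j) x‖ ^ 2 : ℝ) : ℂ) := fun j => by
      rw [RCLike.conj_mul]; push_cast; rfl
    simp only [h2] at h
    exact Complex.ofReal_injective (by push_cast at h ⊢; exact h.symm)
  have hx : x = orthoRemainder e n x + ∑ j ∈ Finset.range (n + 1), inner ℂ (e j) x • e j := by
    simp [orthoRemainder]
  have ho : inner ℂ (orthoRemainder e n x)
      (∑ j ∈ Finset.range (n + 1), inner ℂ (e j) x • e j) = 0 := by
    rw [inner_sum]
    refine Finset.sum_eq_zero fun j hj => ?_
    rw [inner_smul_right, ← inner_conj_symm (orthoRemainder e n x),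
      inner_orthoRemainder he (Finset.mem_range_succ_iff.1 hj), map_zero, mul_zero]
  have h := norm_add_sq_eq_norm_sq_add_norm_sq_of_inner_eq_zero _ _ ho
  rw [← hx] at h
  rw [hp]
  nlinarith

theorem orthoRemainder_eq_zero {e : ℕ → H} (he : Orthonormal ℂ e) {n : ℕ} {x : H}
    (hx : x ∈ Submodule.span ℂ (e '' Set.Iic n)) : orthoRemainder e n x = 0 := by
  have hmem : orthoRemainder e n x ∈ Submodule.span ℂ (e '' Set.Iic n) :=
    Submodule.sub_mem _ hx (Submodule.sum_mem _ fun j hj => Submodule.smul_mem _ _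
      (Submodule.subset_span ⟨j, Finset.mem_range_succ_iff.1 hj, rfl⟩))
  have hle : Submodule.span ℂ (e '' Set.Iic n) ≤
      (Submodule.span ℂ {orthoRemainder e n x})ᗮ := by
    rw [Submodule.span_le]
    rintro _ ⟨j, hj, rfl⟩
    rw [SetLike.mem_coe, Submodule.mem_orthogonal_singleton_iff_inner_left]
    exact inner_orthoRemainder he hj _
  have h := hle hmem
  rwa [Submodule.mem_orthogonal_singleton_iff_inner_left, inner_self_eq_zero] at h

variable [CompleteSpace H]

/-- The finite-dimensional form of the trace estimate: the part of the double sum of the squared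
matrix entries of `S` with both indices at most `n` cancels, and what is left is the last row,
which Bessel's inequality bounds. -/
theorem sum_norm_sq_orthoRemainder_adjoint_le {e : ℕ → H} (he : Orthonormal ℂ e) (S : H →L[ℂ] H)
    (hS : ∀ i, S (e i) ∈ Submodule.span ℂ (e '' Set.Iic (i + 1)))
    (hN : ∀ i, ‖S.adjoint (e i)‖ = ‖S (e i)‖) (n : ℕ) :
    ∑ i ∈ Finset.range (n + 1), ‖orthoRemainder e n (S.adjoint (e i))‖ ^ 2 ≤ ‖S‖ ^ 2 := by
  have hrow : ∀ i ≤ n, ‖S (e i)‖ ^ 2 =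
      ∑ j ∈ Finset.range (n + 2), ‖inner ℂ (e j) (S (e i))‖ ^ 2 := by
    intro i hi
    have h0 : orthoRemainder e (n + 1) (S (e i)) = 0 :=
      orthoRemainder_eq_zero he (Submodule.span_mono (Set.image_mono
        (Set.Iic_subset_Iic.2 (by omega))) (hS i))
    have h := norm_sq_orthoRemainder he (n + 1) (S (e i))
    rw [h0, norm_zero] at h
    linarith
  -- The square block of the matrix of `S†` is the conjugate transpose of that of `S`.
  have hswap : ∑ i ∈ Finset.range (n + 1), ∑ j ∈ Finset.range (n + 1),
        ‖inner ℂ (e j) (S.adjoint (e i))‖ ^ 2 =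
      ∑ i ∈ Finset.range (n + 1), ∑ j ∈ Finset.range (n + 1),
        ‖inner ℂ (e j) (S (e i))‖ ^ 2 := by
    rw [Finset.sum_comm]
    refine Finset.sum_congr rfl fun i _ => Finset.sum_congr rfl fun j _ => ?_
    rw [ContinuousLinearMap.adjoint_inner_right, norm_inner_symm]
  have hlast : ∑ i ∈ Finset.range (n + 1), ‖inner ℂ (e (n + 1)) (S (e i))‖ ^ 2 ≤ ‖S‖ ^ 2 := by
    calc ∑ i ∈ Finset.range (n + 1), ‖inner ℂ (e (n + 1)) (S (e i))‖ ^ 2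
        = ∑ i ∈ Finset.range (n + 1), ‖inner ℂ (e i) (S.adjoint (e (n + 1)))‖ ^ 2 := by
          refine Finset.sum_congr rfl fun i _ => ?_
          rw [ContinuousLinearMap.adjoint_inner_right, norm_inner_symm]
      _ ≤ ‖S.adjoint (e (n + 1))‖ ^ 2 := he.sum_inner_products_le _
      _ = ‖S (e (n + 1))‖ ^ 2 := by rw [hN]
      _ ≤ ‖S‖ ^ 2 := by
          gcongr
          simpa [he.1] using S.le_opNorm (e (n + 1))
  calc ∑ i ∈ Finset.range (n + 1), ‖orthoRemainder e n (S.adjoint (e i))‖ ^ 2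
      = ∑ i ∈ Finset.range (n + 1), ‖S (e i)‖ ^ 2 -
        ∑ i ∈ Finset.range (n + 1), ∑ j ∈ Finset.range (n + 1),
          ‖inner ℂ (e j) (S (e i))‖ ^ 2 := by
        rw [← hswap, ← Finset.sum_sub_distrib]
        exact Finset.sum_congr rfl fun i _ => by rw [norm_sq_orthoRemainder he, hN]
    _ = ∑ i ∈ Finset.range (n + 1), ‖inner ℂ (e (n + 1)) (S (e i))‖ ^ 2 := by
        rw [← Finset.sum_sub_distrib]
        refine Finset.sum_congr rfl fun i hi => ?_
        rw [hrow i (Finset.mem_range_succ_iff.1 hi), Finset.sum_range_succ _ (n + 1)]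
        ring
    _ ≤ ‖S‖ ^ 2 := hlast

/-- The term `i = n + 1` falls outside the cancellation and is bounded by `‖S‖²` on its own. -/
theorem sum_succ_norm_sq_orthoRemainder_adjoint_le {e : ℕ → H} (he : Orthonormal ℂ e)
    (S : H →L[ℂ] H) (hS : ∀ i, S (e i) ∈ Submodule.span ℂ (e '' Set.Iic (i + 1)))
    (hN : ∀ i, ‖S.adjoint (e i)‖ = ‖S (e i)‖) (n : ℕ) :
    ∑ i ∈ Finset.range (n + 2), ‖orthoRemainder e n (S.adjoint (e i))‖ ^ 2 ≤ 2 * ‖S‖ ^ 2 := by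
  have h1 := sum_norm_sq_orthoRemainder_adjoint_le he S hS hN n
  have h2 : ‖orthoRemainder e n (S.adjoint (e (n + 1)))‖ ^ 2 ≤ ‖S‖ ^ 2 := by
    rw [norm_sq_orthoRemainder he, hN]
    have h3 : ‖S (e (n + 1))‖ ^ 2 ≤ ‖S‖ ^ 2 := by
      gcongr
      simpa [he.1] using S.le_opNorm (e (n + 1))
    have h4 : 0 ≤ ∑ j ∈ Finset.range (n + 1), ‖inner ℂ (e j) (S.adjoint (e (n + 1)))‖ ^ 2 := by
      positivity
    linarith
  rw [Finset.sum_range_succ]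
  linarith

end Hilbert

/-! ### Orthonormal sequences, Hilbert–Schmidt operators and weak convergence -/

section Hilbert

variable {H : Type*} [NormedAddCommGroup H] [InnerProductSpace ℂ H]

theorem HilbertBasis.hasSum_norm_inner_sq {ι : Type*} (b : HilbertBasis ι ℂ H) (x : H) :
    HasSum (fun i => ‖inner ℂ (b i) x‖ ^ 2) (‖x‖ ^ 2) := by
  have h := b.hasSum_inner_mul_inner x x
  rw [inner_self_eq_norm_sq_to_K] at h
  have h2 : ∀ i, inner ℂ x (b i) * inner ℂ (b i) x = ((‖inner ℂ (b i) x‖ ^ 2 : ℝ) : ℂ) :=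
    fun i => by
      rw [← inner_conj_symm x, RCLike.conj_mul]; push_cast; rfl
  simp only [h2] at h
  have h3 : (((‖x‖ : ℝ) : ℂ)) ^ 2 = ((‖x‖ ^ 2 : ℝ) : ℂ) := by push_cast; rfl
  exact Complex.hasSum_ofReal.1 (h3 ▸ h)

theorem HilbertBasis.tsum_ofReal_norm_inner_sq {ι : Type*} (b : HilbertBasis ι ℂ H) (x : H) :
    ∑' i, ENNReal.ofReal (‖inner ℂ (b i) x‖ ^ 2) = ENNReal.ofReal (‖x‖ ^ 2) := by
  rw [← (b.hasSum_norm_inner_sq x).tsum_eq,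
    ENNReal.ofReal_tsum_of_nonneg (fun i => by positivity) (b.hasSum_norm_inner_sq x).summable]

variable [CompleteSpace H]

/-- The partial sums of the Fourier series of `x` along an orthonormal sequence converge to the
projection of `x` onto the closed span `U` of the sequence. -/
theorem tendsto_sum_inner_smul_starProjection {e : ℕ → H} (he : Orthonormal ℂ e)
    (U : Submodule ℂ H) [CompleteSpace U]
    (hU : U = (Submodule.span ℂ (Set.range e)).topologicalClosure) (x : H) :
    Tendsto (fun n => ∑ j ∈ Finset.range n, inner ℂ (e j) x • e j) atTop
      (𝓝 (U.starProjection x)) := by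
  have hmem : ∀ j, e j ∈ U := fun j => by
    rw [hU]
    exact Submodule.le_topologicalClosure _ (Submodule.subset_span ⟨j, rfl⟩)
  have hs : Summable fun j => inner ℂ (e j) x • e j := by
    have h := (he.orthogonalFamily.summable_iff_norm_sq_summable
      (fun j => (inner ℂ (e j) x : ℂ))).2 (he.inner_products_summable x)
    simpa using h
  obtain ⟨y, hy⟩ := hs
  have hyU : y ∈ U := by
    have hc : IsClosed (U : Set H) := by
      rw [hU]; exact Submodule.isClosed_topologicalClosure _
    exact hc.mem_of_tendsto hy (Eventually.of_forall fun s =>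
      U.sum_mem fun j _ => U.smul_mem _ (hmem j))
  have hperp : x - y ∈ Uᗮ := by
    rw [hU, Submodule.orthogonal_closure]
    have hle : Submodule.span ℂ (Set.range e) ≤ (Submodule.span ℂ {x - y})ᗮ := by
      rw [Submodule.span_le]
      rintro _ ⟨k, rfl⟩
      rw [SetLike.mem_coe, Submodule.mem_orthogonal_singleton_iff_inner_left, inner_sub_right,
        sub_eq_zero]
      have h1 : HasSum (fun j => inner ℂ (e k) (inner ℂ (e j) x • e j)) (inner ℂ (e k) y) :=
        (innerSL ℂ (e k)).hasSum hy
      have h2 : HasSum (fun j => inner ℂ (e k) (inner ℂ (e j) x • e j)) (inner ℂ (e k) x) := by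
        have h3 := hasSum_single (f := fun j => inner ℂ (e k) (inner ℂ (e j) x • e j)) k
          (fun j hj => by rw [inner_smul_right, he.2 hj.symm, mul_zero])
        simpa [inner_smul_right, inner_self_eq_norm_sq_to_K, he.1 k] using h3
      exact h2.unique h1
    intro u hu
    have h := hle hu
    rwa [Submodule.mem_orthogonal_singleton_iff_inner_left] at h
  rw [Submodule.eq_starProjection_of_mem_of_inner_eq_zero hyU
    (fun w hw => by rw [← inner_conj_symm, hperp w hw, map_zero])]
  exact hy.tendsto_sum_nat

/-- Expanding each `A (b i)` in the basis `c` and exchanging the two sums. -/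
theorem HilbertBasis.tsum_ofReal_norm_sq_adjoint {ι κ : Type*} (b : HilbertBasis ι ℂ H)
    (c : HilbertBasis κ ℂ H) (A : H →L[ℂ] H) :
    ∑' i, ENNReal.ofReal (‖A (b i)‖ ^ 2) = ∑' k, ENNReal.ofReal (‖A.adjoint (c k)‖ ^ 2) := by
  simp_rw [← c.tsum_ofReal_norm_inner_sq (A (b _)),
    ← b.tsum_ofReal_norm_inner_sq (A.adjoint (c _))]
  rw [ENNReal.tsum_comm]
  refine tsum_congr fun k => tsum_congr fun i => ?_
  rw [ContinuousLinearMap.adjoint_inner_right, norm_inner_symm]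

theorem summable_iff_tsum_ofReal_ne_top {ι : Type*} {f : ι → ℝ} (hf : ∀ i, 0 ≤ f i) :
    Summable f ↔ ∑' i, ENNReal.ofReal (f i) ≠ ∞ := by
  refine ⟨fun h => h.tsum_ofReal_ne_top, fun h => ?_⟩
  simpa [ENNReal.toReal_ofReal, hf] using ENNReal.summable_toReal h

/-- For an operator that annihilates the orthogonal complement of an orthonormal sequence,
the Hilbert–Schmidt property can be tested on that sequence. -/
theorem isHilbertSchmidt_of_summable {e : ℕ → H} (he : Orthonormal ℂ e) (A : H →L[ℂ] H)
    (hA : ∀ x, (∀ j, inner ℂ (e j) x = 0) → A x = 0)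
    (hsum : Summable fun j => ‖A (e j)‖ ^ 2) : IsHilbertSchmidt A := by
  intro s b
  obtain ⟨w, c, hw, hc⟩ := he.toSubtypeRange.exists_hilbertBasis_extension
  -- Pass from `b` to the extension `c` of `e` through `∑ ‖A† (b i)‖²`, the same for both bases.
  rw [summable_iff_tsum_ofReal_ne_top (fun i => by positivity),
    b.tsum_ofReal_norm_sq_adjoint b, ← c.tsum_ofReal_norm_sq_adjoint b,
    ← summable_iff_tsum_ofReal_ne_top (fun i => by positivity), hc]
  have hinj : Function.Injective fun j => (⟨e j, hw ⟨j, rfl⟩⟩ : w) := fun i j hij =>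
    he.linearIndependent.injective (Subtype.ext_iff.1 hij)
  refine (hinj.summable_iff fun x hx => ?_).1 hsum
  have h0 : A x = 0 := hA x fun j => by
    have hne : (⟨e j, hw ⟨j, rfl⟩⟩ : w) ≠ x := fun h => hx ⟨j, h⟩
    have h := c.orthonormal.2 hne
    simpa [hc] using h
  simp [h0]

/-- A bounded sequence in a Hilbert space that converges against a set with dense span converges
weakly. -/
theorem tendsto_toWeakSpace_of_dense_span {k : ℕ → H} {L : H} {C : ℝ} (hC : ∀ n, ‖k n‖ ≤ C)
    (D : Set H) (hD : (Submodule.span ℂ D).topologicalClosure = ⊤)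
    (h : ∀ d ∈ D, Tendsto (fun n => inner ℂ d (k n)) atTop (𝓝 (inner ℂ d L))) :
    Tendsto (fun n => toWeakSpace ℂ H (k n)) atTop (𝓝 (toWeakSpace ℂ H L)) := by
  have hspan : ∀ d ∈ Submodule.span ℂ D,
      Tendsto (fun n => inner ℂ d (k n)) atTop (𝓝 (inner ℂ d L)) := by
    intro d hd
    induction hd using Submodule.span_induction with
    | mem x hx => exact h x hx
    | zero => simp
    | add x y _ _ hx hy => simpa only [inner_add_left] using hx.add hy
    | smul a x _ hx => simpa only [inner_smul_left] using hx.const_mul _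
  have hall : ∀ x : H, Tendsto (fun n => inner ℂ x (k n)) atTop (𝓝 (inner ℂ x L)) := by
    intro x
    have hC0 : 0 ≤ C := (norm_nonneg _).trans (hC 0)
    rw [Metric.tendsto_atTop]
    intro ε hε
    set B : ℝ := C + ‖L‖ + 1 with hB
    have hBpos : 0 < B := by positivity
    have hx : x ∈ closure (Submodule.span ℂ D : Set H) := by
      rw [← Submodule.topologicalClosure_coe, hD]; trivial
    obtain ⟨d, hd, hdx⟩ := Metric.mem_closure_iff.1 hx (ε / (2 * B)) (by positivity)
    obtain ⟨N, hN⟩ := Metric.tendsto_atTop.1 (hspan d hd) (ε / 2) (by positivity)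
    refine ⟨N, fun n hn => ?_⟩
    have h1 := hN n hn
    rw [dist_eq_norm] at h1 hdx ⊢
    have h2 : inner ℂ x (k n) - inner ℂ x L =
        (inner ℂ d (k n) - inner ℂ d L) + inner ℂ (x - d) (k n - L) := by
      simp only [inner_sub_left, inner_sub_right]; ring
    have h3 : ‖inner ℂ (x - d) (k n - L)‖ ≤ ε / (2 * B) * B := by
      refine (norm_inner_le_norm _ _).trans (mul_le_mul hdx.le ?_ (norm_nonneg _) (by positivity))
      linarith [norm_sub_le (k n) L, hC n]
    have h4 : ε / (2 * B) * B = ε / 2 := by field_simp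
    rw [h2]
    linarith [norm_add_le (inner ℂ d (k n) - inner ℂ d L) (inner ℂ (x - d) (k n - L))]
  refine (WeakBilin.tendsto_iff_forall_eval_tendsto
    (B := (topDualPairing ℂ H).flip) ?_).2 fun φ => ?_
  · intro x y hxy
    exact ext_inner_left ℂ fun v => DFunLike.congr_fun hxy (innerSL ℂ v)
  · have h := hall ((InnerProductSpace.toDual ℂ H).symm φ)
    simp only [InnerProductSpace.toDual_symm_apply] at h
    exact h

end Hilbert

/-! ### Elementary tensors and integral kernels -/

section Tensor

variable {α β : Type*} [MeasurableSpace α] [MeasurableSpace β] {μ : Measure α} {ν : Measure β}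

theorem MeasureTheory.MemLp.mul_conj_prod [SFinite μ] [SFinite ν] {f : α → ℂ} {g : β → ℂ}
    (hf : MemLp f 2 μ) (hg : MemLp g 2 ν) :
    MemLp (fun x : α × β => f x.1 * conj (g x.2)) 2 (μ.prod ν) := by
  have hm : AEStronglyMeasurable (fun x : α × β => f x.1 * conj (g x.2)) (μ.prod ν) :=
    hf.1.comp_fst.mul (Complex.continuous_conj.comp_aestronglyMeasurable hg.1.comp_snd)
  rw [memLp_two_iff_integrable_sq_norm hm]
  have h := ((memLp_two_iff_integrable_sq_norm hf.1).1 hf).mul_prod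
    ((memLp_two_iff_integrable_sq_norm hg.1).1 hg)
  refine h.congr (Eventually.of_forall fun x => ?_)
  simp [mul_pow]

/-- The elementary tensor `(z, w) ↦ f z * conj (g w)`, the kernel of the rank-one operator
`⟪g, ·⟫ f`. -/
noncomputable def tensorConj [SFinite μ] [SFinite ν] (f : Lp ℂ 2 μ) (g : Lp ℂ 2 ν) :
    Lp ℂ 2 (μ.prod ν) :=
  ((Lp.memLp f).mul_conj_prod (Lp.memLp g)).toLp

variable [IsFiniteMeasure μ] [IsFiniteMeasure ν]

theorem coeFn_tensorConj (f : Lp ℂ 2 μ) (g : Lp ℂ 2 ν) :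
    tensorConj f g =ᵐ[μ.prod ν] fun x => f x.1 * conj (g x.2) :=
  MemLp.coeFn_toLp _

theorem inner_tensorConj_tensorConj (f f' : Lp ℂ 2 μ) (g g' : Lp ℂ 2 ν) :
    inner ℂ (tensorConj f g) (tensorConj f' g') = inner ℂ f f' * inner ℂ g' g := by
  rw [L2.inner_def, L2.inner_def, L2.inner_def, ← integral_prod_mul]
  refine integral_congr_ae ?_
  filter_upwards [coeFn_tensorConj f g, coeFn_tensorConj f' g'] with x h1 h2
  rw [h1, h2]
  simp only [RCLike.inner_apply, map_mul, RCLike.conj_conj]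
  ring

theorem norm_tensorConj (f : Lp ℂ 2 μ) (g : Lp ℂ 2 ν) : ‖tensorConj f g‖ = ‖f‖ * ‖g‖ := by
  have h := inner_tensorConj_tensorConj f f g g
  simp only [inner_self_eq_norm_sq_to_K] at h
  have h2 : ‖tensorConj f g‖ ^ 2 = (‖f‖ * ‖g‖) ^ 2 := by
    rw [mul_pow]
    exact Complex.ofReal_injective (by push_cast; exact h)
  exact (sq_eq_sq₀ (norm_nonneg _) (by positivity)).1 h2

theorem inner_tensorConj (f : Lp ℂ 2 μ) (g : Lp ℂ 2 ν) (F : Lp ℂ 2 (μ.prod ν)) :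
    inner ℂ (tensorConj f g) F = ∫ x, conj (f x.1) * (F x * g x.2) ∂μ.prod ν := by
  rw [L2.inner_def]
  refine integral_congr_ae ?_
  filter_upwards [coeFn_tensorConj f g] with x h1
  rw [h1]
  simp only [RCLike.inner_apply, map_mul, RCLike.conj_conj]
  ring

/-- Tensoring with a unit vector is a linear isometry of the other factor. -/
noncomputable def tensorConjLI (g : Lp ℂ 2 ν) (hg : ‖g‖ = 1) :
    Lp ℂ 2 μ →ₗᵢ[ℂ] Lp ℂ 2 (μ.prod ν) where
  toFun f := tensorConj f g
  map_add' f f' := by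
    refine Lp.ext ?_
    filter_upwards [coeFn_tensorConj (f + f') g, coeFn_tensorConj f g, coeFn_tensorConj f' g,
      Lp.coeFn_add (tensorConj f g) (tensorConj f' g),
      Measure.quasiMeasurePreserving_fst.ae_eq_comp (Lp.coeFn_add f f')] with x h1 h2 h3 h4 h5
    simp only [Function.comp_apply, Pi.add_apply] at h4 h5
    rw [h4, h1, h2, h3, h5, add_mul]
  map_smul' c f := by
    refine Lp.ext ?_
    filter_upwards [coeFn_tensorConj (c • f) g, coeFn_tensorConj f g,
      Lp.coeFn_smul c (tensorConj f g),
      Measure.quasiMeasurePreserving_fst.ae_eq_comp (Lp.coeFn_smul c f)] with x h1 h2 h3 h4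
    simp only [Function.comp_apply, Pi.smul_apply, smul_eq_mul] at h3 h4
    rw [RingHom.id_apply, h3, h1, h2, h4, mul_assoc]
  norm_map' f := (norm_tensorConj f g).trans (by rw [hg, mul_one])

/-- The elementary tensors over an orthonormal family form orthogonal copies of the other
factor. -/
theorem orthogonalFamily_tensorConjLI {ι : Type*} {e : ι → Lp ℂ 2 ν} (he : Orthonormal ℂ e) :
    OrthogonalFamily ℂ (fun _ : ι => Lp ℂ 2 μ) fun i =>
      tensorConjLI (μ := μ) (e i) (he.1 i) := by
  intro i j hij f g
  change inner ℂ (tensorConj f (e i)) (tensorConj g (e j)) = 0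
  rw [inner_tensorConj_tensorConj, he.2 hij.symm, mul_zero]

theorem setIntegral_prod_eq_inner (F : Lp ℂ 2 (μ.prod ν)) {s : Set α} {t : Set β}
    (hs : MeasurableSet s) (ht : MeasurableSet t) :
    ∫ x in s ×ˢ t, F x ∂μ.prod ν =
      inner ℂ (tensorConj (indicatorConstLp 2 hs (measure_ne_top μ s) (1 : ℂ))
        (indicatorConstLp 2 ht (measure_ne_top ν t) (1 : ℂ))) F := by
  rw [inner_tensorConj, ← integral_indicator (hs.prod ht)]
  refine integral_congr_ae ?_
  filter_upwards [Measure.quasiMeasurePreserving_fst.ae_eq_comp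
      (indicatorConstLp_coeFn (p := 2) (hs := hs) (hμs := measure_ne_top μ s) (c := (1 : ℂ))),
    Measure.quasiMeasurePreserving_snd.ae_eq_comp
      (indicatorConstLp_coeFn (p := 2) (hs := ht) (hμs := measure_ne_top ν t) (c := (1 : ℂ)))]
    with x h1 h2
  simp only [Function.comp_apply] at h1 h2
  rw [h1, h2]
  by_cases hxs : x.1 ∈ s <;> by_cases hxt : x.2 ∈ t <;> simp [Set.indicator, hxs, hxt]

/-- An `L²` function on the product orthogonal to all elementary tensors has vanishing integral
over every rectangle, hence over every measurable set. -/
theorem eq_zero_of_forall_inner_tensorConj (F : Lp ℂ 2 (μ.prod ν))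
    (h : ∀ (f : Lp ℂ 2 μ) (g : Lp ℂ 2 ν), inner ℂ (tensorConj f g) F = 0) : F = 0 := by
  have hint : Integrable F (μ.prod ν) := (Lp.memLp F).integrable one_le_two
  have hrect : ∀ (s : Set α) (t : Set β), MeasurableSet s → MeasurableSet t →
      ∫ x in s ×ˢ t, F x ∂μ.prod ν = 0 := fun s t hs ht => by
    rw [setIntegral_prod_eq_inner F hs ht, h]
  have hall : ∀ s : Set (α × β), MeasurableSet s → ∫ x in s, F x ∂μ.prod ν = 0 := by
    intro s hs
    induction s, hs using MeasurableSpace.induction_on_inter generateFrom_prod.symm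
      isPiSystem_prod with
    | empty => simp
    | basic t ht =>
      obtain ⟨u, hu, v, hv, rfl⟩ := ht
      exact hrect u v hu hv
    | compl t ht iht =>
      rw [setIntegral_compl ht hint, iht, sub_zero, ← setIntegral_univ, ← Set.univ_prod_univ]
      exact hrect _ _ .univ .univ
    | iUnion f hd hm ih =>
      rw [integral_iUnion hm hd hint.integrableOn]
      simp [ih]
  refine Lp.ext ?_
  refine (hint.ae_eq_of_forall_setIntegral_eq _ _ (integrable_zero _ _ _) fun s hs _ => ?_).trans
    (Lp.coeFn_zero ℂ 2 _).symm
  simpa using hall s hs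

theorem topologicalClosure_span_tensorConj :
    (Submodule.span ℂ {F : Lp ℂ 2 (μ.prod ν) | ∃ f g, tensorConj f g = F}).topologicalClosure
      = ⊤ := by
  rw [Submodule.topologicalClosure_eq_top_iff, Submodule.eq_bot_iff]
  exact fun F hF => eq_zero_of_forall_inner_tensorConj F fun f g =>
    hF _ (Submodule.subset_span ⟨f, g, rfl⟩)

/-- An integral kernel is one whose pairing with elementary tensors gives the matrix entries of the
operator. -/
theorem isIntegralKernel_iff {μ : Measure ℂ} [IsFiniteMeasure μ] (F : Lp ℂ 2 (μ.prod μ))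
    (A : Lp ℂ 2 μ →L[ℂ] Lp ℂ 2 μ) :
    IsIntegralKernel μ F A ↔
      ∀ f g : Lp ℂ 2 μ, inner ℂ (tensorConj g f) F = inner ℂ g (A f) := by
  have hone : ∀ f : Lp ℂ 2 μ, Integrable (fun x : ℂ × ℂ => F x * f x.2) (μ.prod μ) := fun f =>
    (Lp.memLp F).integrable_mul ((Lp.memLp f).comp_snd μ)
  have hint : ∀ f g : Lp ℂ 2 μ,
      Integrable (fun x : ℂ × ℂ => conj (g x.1) * (F x * f x.2)) (μ.prod μ) := fun f g => by
    refine (L2.integrable_inner (𝕜 := ℂ) (tensorConj g f) F).congr ?_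
    filter_upwards [coeFn_tensorConj g f] with x h1
    rw [h1]
    simp only [RCLike.inner_apply, map_mul, RCLike.conj_conj]
    ring
  have hpair : ∀ f g : Lp ℂ 2 μ, inner ℂ (tensorConj g f) F =
      ∫ z, conj (g z) * ∫ w, F (z, w) * f w ∂μ ∂μ := fun f g => by
    rw [inner_tensorConj, integral_prod _ (hint f g)]
    simp only [integral_const_mul]
  constructor
  · intro h f g
    rw [hpair, L2.inner_def]
    refine integral_congr_ae ?_
    filter_upwards [h f] with z hz
    rw [← hz]
    simp [mul_comm]
  · intro h f
    refine ((Lp.memLp (A f)).integrable one_le_two).ae_eq_of_forall_setIntegral_eq _ _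
      (hone f).integral_prod_left fun s hs _ => ?_
    rw [← L2.inner_indicatorConstLp_one hs (measure_ne_top μ s), ← h, hpair,
      ← integral_indicator hs]
    refine integral_congr_ae ?_
    filter_upwards [indicatorConstLp_coeFn (p := 2) (hs := hs) (hμs := measure_ne_top μ s)
      (c := (1 : ℂ))] with z hz
    rw [hz]
    by_cases hzs : z ∈ s <;> simp [Set.indicator, hzs]

theorem IsIntegralKernel.unique {μ : Measure ℂ} [IsFiniteMeasure μ] {F G : Lp ℂ 2 (μ.prod μ)}
    {A : Lp ℂ 2 μ →L[ℂ] Lp ℂ 2 μ} (hF : IsIntegralKernel μ F A) (hG : IsIntegralKernel μ G A) :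
    F = G := by
  rw [isIntegralKernel_iff] at hF hG
  exact sub_eq_zero.1 (eq_zero_of_forall_inner_tensorConj _ fun g f => by
    rw [inner_sub_right, hF, hG, sub_self])

end Tensor

/-! ### Multiplication by the coordinate, and polynomials in `L²` -/

section Coord

variable {μ : Measure ℂ}

theorem coeFn_mulCoord (hμ : IsCompact μ.support) (f : Lp ℂ 2 μ) :
    mulCoord μ hμ f =ᵐ[μ] fun z => z * f z := by
  have h : mulCoord μ hμ f = (ContinuousLinearMap.mul ℂ ℂ).holder 2
    (memLp_top_coord μ hμ).toLp f := rfl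
  rw [h]
  filter_upwards [(ContinuousLinearMap.mul ℂ ℂ).coeFn_holder (r := 2)
    (memLp_top_coord μ hμ).toLp f, (memLp_top_coord μ hμ).coeFn_toLp] with z h1 h2
  rw [h1, h2, ContinuousLinearMap.mul_apply']

theorem memLp_top_conj_coord (hμ : IsCompact μ.support) : MemLp (fun z : ℂ => conj z) ∞ μ :=
  (memLp_top_coord μ hμ).of_le (Complex.continuous_conj.aestronglyMeasurable)
    (Eventually.of_forall fun z => by simp)

theorem coeFn_adjoint_mulCoord (hμ : IsCompact μ.support) (f : Lp ℂ 2 μ) :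
    (mulCoord μ hμ).adjoint f =ᵐ[μ] fun z => conj z * f z := by
  have hN : ∀ f : Lp ℂ 2 μ, (ContinuousLinearMap.mul ℂ ℂ).holderL μ ∞ 2 2
      (memLp_top_conj_coord hμ).toLp f =ᵐ[μ] fun z => conj z * f z := fun f => by
    change (ContinuousLinearMap.mul ℂ ℂ).holder 2 (memLp_top_conj_coord hμ).toLp f =ᵐ[μ] _
    filter_upwards [(ContinuousLinearMap.mul ℂ ℂ).coeFn_holder (r := 2)
      (memLp_top_conj_coord hμ).toLp f, (memLp_top_conj_coord hμ).coeFn_toLp] with z h1 h2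
    rw [h1, h2, ContinuousLinearMap.mul_apply']
  -- Multiplication by `conj z` satisfies the defining identity of the adjoint.
  have h : (ContinuousLinearMap.mul ℂ ℂ).holderL μ ∞ 2 2 (memLp_top_conj_coord hμ).toLp =
      (mulCoord μ hμ).adjoint := by
    rw [ContinuousLinearMap.eq_adjoint_iff]
    intro f g
    rw [L2.inner_def, L2.inner_def]
    refine integral_congr_ae ?_
    filter_upwards [hN f, coeFn_mulCoord hμ g] with z h1 h2
    rw [h1, h2]
    simp only [RCLike.inner_apply, map_mul, RCLike.conj_conj]
    ring
  rw [← h]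
  exact hN f

/-- Multiplication by the coordinate is a normal operator. -/
theorem norm_adjoint_mulCoord (hμ : IsCompact μ.support) (f : Lp ℂ 2 μ) :
    ‖(mulCoord μ hμ).adjoint f‖ = ‖mulCoord μ hμ f‖ := by
  refine le_antisymm (Lp.norm_le_norm_of_ae_le ?_) (Lp.norm_le_norm_of_ae_le ?_) <;>
  · filter_upwards [coeFn_adjoint_mulCoord hμ f, coeFn_mulCoord hμ f] with z h1 h2
    rw [h1, h2, norm_mul, norm_mul, RCLike.norm_conj]

variable [IsFiniteMeasure μ]

theorem memLp_eval (hμ : IsCompact μ.support) (p : ℂ[X]) : MemLp (fun z => p.eval z) 2 μ := by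
  obtain ⟨C, hC⟩ := hμ.exists_bound_of_continuousOn p.continuous.continuousOn
  refine MemLp.of_bound p.continuous.aestronglyMeasurable C ?_
  filter_upwards [μ.support_mem_ae] with z hz using hC z hz

/-- The class in `L²(μ)` of a polynomial, as a linear map. -/
noncomputable def polyLp (hμ : IsCompact μ.support) : ℂ[X] →ₗ[ℂ] Lp ℂ 2 μ where
  toFun p := (memLp_eval hμ p).toLp
  map_add' p q := by
    rw [← MemLp.toLp_add]
    exact MemLp.toLp_congr _ _ (Eventually.of_forall fun z => eval_add)
  map_smul' c p := by
    rw [RingHom.id_apply, ← MemLp.toLp_const_smul]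
    exact MemLp.toLp_congr _ _ (Eventually.of_forall fun z => eval_smul c p z)

theorem coeFn_polyLp (hμ : IsCompact μ.support) (p : ℂ[X]) :
    polyLp hμ p =ᵐ[μ] fun z => p.eval z :=
  (memLp_eval hμ p).coeFn_toLp

theorem range_polyLp (hμ : IsCompact μ.support) : (polyLp hμ).range = polySubspace μ := by
  ext f
  constructor
  · rintro ⟨p, rfl⟩
    exact ⟨p, coeFn_polyLp hμ p⟩
  · rintro ⟨p, hp⟩
    exact ⟨p, Lp.ext ((coeFn_polyLp hμ p).trans hp.symm)⟩

theorem mulCoord_polyLp (hμ : IsCompact μ.support) (p : ℂ[X]) :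
    mulCoord μ hμ (polyLp hμ p) = polyLp hμ (X * p) := by
  refine Lp.ext ?_
  filter_upwards [coeFn_mulCoord hμ (polyLp hμ p), coeFn_polyLp hμ p, coeFn_polyLp hμ (X * p)]
    with z h1 h2 h3
  rw [h1, h2, h3, eval_mul, eval_X]

/-- A polynomial that vanishes almost everywhere has the support of `μ` among its roots. -/
theorem polyLp_injective (hμ : IsCompact μ.support) (hinf : μ.support.Infinite) :
    Function.Injective (polyLp hμ) := by
  rw [injective_iff_map_eq_zero]
  intro p hp
  have h0 : ∀ᵐ z ∂μ, p.eval z = 0 := by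
    have h := coeFn_polyLp hμ p
    rw [hp] at h
    exact h.symm.trans (Lp.coeFn_zero ℂ 2 μ)
  have hsub : μ.support ⊆ {z | p.IsRoot z} :=
    Measure.support_subset_of_isClosed
      (isClosed_singleton.preimage p.continuous : IsClosed (p.eval ⁻¹' {(0 : ℂ)})) h0
  exact eq_zero_of_infinite_isRoot p (hinf.mono hsub)

theorem polyInner_eq_inner (hμ : IsCompact μ.support) (p q : ℂ[X]) :
    polyInner μ p q = inner ℂ (polyLp hμ q) (polyLp hμ p) := by
  rw [polyInner, L2.inner_def]
  refine integral_congr_ae ?_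
  filter_upwards [coeFn_polyLp hμ p, coeFn_polyLp hμ q] with z h1 h2
  rw [h1, h2, RCLike.inner_apply]

theorem integral_norm_sq_eval (hμ : IsCompact μ.support) (p : ℂ[X]) :
    ∫ z, ‖p.eval z‖ ^ 2 ∂μ = ‖polyLp hμ p‖ ^ 2 := by
  have h : (((∫ z, ‖p.eval z‖ ^ 2 ∂μ : ℝ) : ℂ)) = polyInner μ p p := by
    rw [polyInner, ← integral_complex_ofReal]
    exact integral_congr_ae (Eventually.of_forall fun z => by simp [Complex.mul_conj'])
  rw [polyInner_eq_inner hμ, inner_self_eq_norm_sq_to_K] at h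
  exact Complex.ofReal_injective (by push_cast at h ⊢; exact h)

end Coord

/-! ### Orthonormal polynomials -/

section OrthoPoly

theorem monicOrthoPoly_eq (μ : Measure ℂ) (n : ℕ) :
    monicOrthoPoly μ n = X ^ n - ∑ j ∈ Finset.range n,
      C (polyInner μ (X ^ n) (monicOrthoPoly μ j) /
        polyInner μ (monicOrthoPoly μ j) (monicOrthoPoly μ j)) * monicOrthoPoly μ j := by
  rw [monicOrthoPoly, Finset.sum_range]

theorem degree_monicOrthoPoly (μ : Measure ℂ) (n : ℕ) : (monicOrthoPoly μ n).degree = n := by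
  induction n using Nat.strong_induction_on with
  | _ n ih =>
    rw [monicOrthoPoly_eq, degree_sub_eq_left_of_degree_lt, degree_X_pow]
    rw [degree_X_pow, ← mem_degreeLT]
    refine Submodule.sum_mem _ fun j hj => ?_
    rw [← smul_eq_C_mul]
    refine Submodule.smul_mem _ _ (mem_degreeLT.2 ?_)
    rw [ih j (Finset.mem_range.1 hj)]
    exact_mod_cast Finset.mem_range.1 hj

theorem monicOrthoPoly_ne_zero (μ : Measure ℂ) (n : ℕ) : monicOrthoPoly μ n ≠ 0 := fun h => by
  simpa [h] using degree_monicOrthoPoly μ n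

variable {μ : Measure ℂ} [IsFiniteMeasure μ]

theorem norm_polyLp_monicOrthoPoly_pos (hμ : IsCompact μ.support) (hinf : μ.support.Infinite)
    (n : ℕ) : 0 < ‖polyLp hμ (monicOrthoPoly μ n)‖ := by
  rw [norm_pos_iff, (map_ne_zero_iff _ (polyLp_injective hμ hinf))]
  exact monicOrthoPoly_ne_zero μ n

theorem inner_monicOrthoPoly_of_lt (hμ : IsCompact μ.support) (hinf : μ.support.Infinite)
    {m n : ℕ} (hmn : m < n) :
    inner ℂ (polyLp hμ (monicOrthoPoly μ m)) (polyLp hμ (monicOrthoPoly μ n)) = 0 := by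
  induction n using Nat.strong_induction_on generalizing m with
  | _ n ih =>
    have hz : ∀ j ∈ Finset.range n, j ≠ m →
        inner ℂ (polyLp hμ (monicOrthoPoly μ m)) (polyLp hμ (monicOrthoPoly μ j)) = 0 := by
      intro j hj hjm
      rcases lt_or_gt_of_ne hjm with h | h
      · rw [← inner_conj_symm, ih m hmn h, map_zero]
      · exact ih j (Finset.mem_range.1 hj) h
    have hne : inner ℂ (polyLp hμ (monicOrthoPoly μ m)) (polyLp hμ (monicOrthoPoly μ m)) ≠ 0 :=
      inner_self_ne_zero.2 (norm_pos_iff.1 (norm_polyLp_monicOrthoPoly_pos hμ hinf m))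
    rw [monicOrthoPoly_eq μ n, map_sub, map_sum, inner_sub_right, inner_sum]
    simp only [← smul_eq_C_mul, map_smul, inner_smul_right, polyInner_eq_inner hμ]
    rw [Finset.sum_eq_single_of_mem m (Finset.mem_range.2 hmn)
      (fun j hj hjm => by rw [hz j hj hjm, mul_zero]), div_mul_cancel₀ _ hne, sub_self]

/-- The class in `L²(μ)` of the orthonormal polynomial of degree `n`. -/
noncomputable def orthoPolyLp (hμ : IsCompact μ.support) (n : ℕ) : Lp ℂ 2 μ :=
  polyLp hμ (orthoPoly μ n)

theorem coeFn_orthoPolyLp (hμ : IsCompact μ.support) (n : ℕ) :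
    orthoPolyLp hμ n =ᵐ[μ] fun z => (orthoPoly μ n).eval z :=
  coeFn_polyLp hμ _

theorem orthoPolyLp_eq (hμ : IsCompact μ.support) (n : ℕ) :
    orthoPolyLp hμ n = ((‖polyLp hμ (monicOrthoPoly μ n)‖⁻¹ : ℝ) : ℂ) •
      polyLp hμ (monicOrthoPoly μ n) := by
  rw [orthoPolyLp, orthoPoly, integral_norm_sq_eval hμ, Real.sqrt_sq (norm_nonneg _),
    ← smul_eq_C_mul, map_smul]

theorem orthonormal_orthoPolyLp (hμ : IsCompact μ.support) (hinf : μ.support.Infinite) :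
    Orthonormal ℂ (orthoPolyLp hμ) := by
  refine ⟨fun n => ?_, fun m n hmn => ?_⟩
  · have h := (norm_polyLp_monicOrthoPoly_pos hμ hinf n).ne'
    rw [orthoPolyLp_eq, norm_smul, Complex.norm_real, norm_inv, norm_norm, inv_mul_cancel₀ h]
  · change inner ℂ (orthoPolyLp hμ m) (orthoPolyLp hμ n) = 0
    rw [orthoPolyLp_eq, orthoPolyLp_eq, inner_smul_left, inner_smul_right]
    rcases lt_or_gt_of_ne hmn with h | h
    · rw [inner_monicOrthoPoly_of_lt hμ hinf h, mul_zero, mul_zero]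
    · rw [← inner_conj_symm, inner_monicOrthoPoly_of_lt hμ hinf h, map_zero, mul_zero, mul_zero]

/-- The recursion that defines the monic orthogonal polynomials expresses each power of `X`
through them. -/
theorem polyLp_X_pow_mem_span (hμ : IsCompact μ.support) (hinf : μ.support.Infinite) (n : ℕ) :
    polyLp hμ (X ^ n) ∈ Submodule.span ℂ (orthoPolyLp hμ '' Set.Iic n) := by
  have hmem : ∀ j ≤ n, polyLp hμ (monicOrthoPoly μ j) ∈
      Submodule.span ℂ (orthoPolyLp hμ '' Set.Iic n) := by
    intro j hj
    have h := (norm_polyLp_monicOrthoPoly_pos hμ hinf j).ne'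
    have h2 : polyLp hμ (monicOrthoPoly μ j) =
        ((‖polyLp hμ (monicOrthoPoly μ j)‖ : ℝ) : ℂ) • orthoPolyLp hμ j := by
      rw [orthoPolyLp_eq, smul_smul, ← Complex.ofReal_mul, mul_inv_cancel₀ h, Complex.ofReal_one,
        one_smul]
    rw [h2]
    exact Submodule.smul_mem _ _ (Submodule.subset_span ⟨j, hj, rfl⟩)
  have hX := eq_add_of_sub_eq (monicOrthoPoly_eq μ n).symm
  rw [hX, map_add, map_sum]
  refine Submodule.add_mem _ (hmem n le_rfl) (Submodule.sum_mem _ fun j hj => ?_)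
  rw [← smul_eq_C_mul, map_smul]
  exact Submodule.smul_mem _ _ (hmem j (Finset.mem_range.1 hj).le)

theorem polyLp_mem_span (hμ : IsCompact μ.support) (hinf : μ.support.Infinite) {n : ℕ} {p : ℂ[X]}
    (hp : p.natDegree ≤ n) :
    polyLp hμ p ∈ Submodule.span ℂ (orthoPolyLp hμ '' Set.Iic n) := by
  rw [p.as_sum_range_C_mul_X_pow, map_sum]
  refine Submodule.sum_mem _ fun j hj => ?_
  rw [← smul_eq_C_mul, map_smul]
  refine Submodule.smul_mem _ _ (Submodule.span_mono (Set.image_mono (Set.Iic_subset_Iic.2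
    ((Finset.mem_range_succ_iff.1 hj).trans hp))) (polyLp_X_pow_mem_span hμ hinf j))

theorem mulCoord_orthoPolyLp_mem_span (hμ : IsCompact μ.support) (hinf : μ.support.Infinite)
    (i : ℕ) : mulCoord μ hμ (orthoPolyLp hμ i) ∈
      Submodule.span ℂ (orthoPolyLp hμ '' Set.Iic (i + 1)) := by
  rw [orthoPolyLp, mulCoord_polyLp]
  refine polyLp_mem_span hμ hinf (natDegree_mul_le.trans ?_)
  rw [natDegree_X, add_comm]
  have h : (monicOrthoPoly μ i).natDegree = i :=
    natDegree_eq_of_degree_eq_some (degree_monicOrthoPoly μ i)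
  exact Nat.succ_le_succ ((natDegree_C_mul_le _ _).trans h.le)

theorem polyClosure_eq (hμ : IsCompact μ.support) (hinf : μ.support.Infinite) :
    polyClosure μ = (Submodule.span ℂ (Set.range (orthoPolyLp hμ))).topologicalClosure := by
  have h : polySubspace μ = Submodule.span ℂ (Set.range (orthoPolyLp hμ)) := by
    rw [← range_polyLp hμ]
    refine le_antisymm ?_ ?_
    · rintro _ ⟨p, rfl⟩
      exact Submodule.span_mono (Set.image_subset_range _ _) (polyLp_mem_span hμ hinf le_rfl)
    · rw [Submodule.span_le]
      rintro _ ⟨n, rfl⟩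
      exact ⟨_, rfl⟩
  rw [polyClosure, h]

end OrthoPoly

/-! ### The Hankel operator and its kernel -/

section Hankel

variable {μ : Measure ℂ}

theorem polyProj_polyProj (f : Lp ℂ 2 μ) : polyProj μ (polyProj μ f) = polyProj μ f :=
  Submodule.starProjection_eq_self_iff.2 (Submodule.starProjection_apply_mem _ f)

theorem hankelOp_apply (hμ : IsCompact μ.support) (f : Lp ℂ 2 μ) :
    hankelOp μ hμ f = (mulCoord μ hμ).adjoint (polyProj μ f) -
      polyProj μ ((mulCoord μ hμ).adjoint (polyProj μ f)) := rfl

variable [IsFiniteMeasure μ]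

theorem orthoPolyLp_mem_polyClosure (hμ : IsCompact μ.support) (n : ℕ) :
    orthoPolyLp hμ n ∈ polyClosure μ :=
  Submodule.le_topologicalClosure _ (range_polyLp hμ ▸ LinearMap.mem_range_self (polyLp hμ) _)

theorem tendsto_sum_polyProj (hμ : IsCompact μ.support) (hinf : μ.support.Infinite)
    (f : Lp ℂ 2 μ) :
    Tendsto (fun n => ∑ j ∈ Finset.range n, inner ℂ (orthoPolyLp hμ j) f • orthoPolyLp hμ j)
      atTop (𝓝 (polyProj μ f)) :=
  tendsto_sum_inner_smul_starProjection (orthonormal_orthoPolyLp hμ hinf) (polyClosure μ)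
    (polyClosure_eq hμ hinf) f

theorem polyProj_eq_zero (hμ : IsCompact μ.support) (hinf : μ.support.Infinite) {f : Lp ℂ 2 μ}
    (hf : ∀ j, inner ℂ (orthoPolyLp hμ j) f = 0) : polyProj μ f = 0 := by
  refine tendsto_nhds_unique (tendsto_sum_polyProj hμ hinf f) ?_
  simp only [hf, zero_smul, Finset.sum_const_zero]
  exact tendsto_const_nhds

/-- Since `P²(μ)` is invariant under `M`, its orthogonal complement is invariant under `M*`, so the
Hankel operator is also the commutator `M* P - P M*`. -/
theorem hankelOp_eq_commutator (hμ : IsCompact μ.support) (hinf : μ.support.Infinite)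
    (f : Lp ℂ 2 μ) :
    hankelOp μ hμ f = (mulCoord μ hμ).adjoint (polyProj μ f) -
      polyProj μ ((mulCoord μ hμ).adjoint f) := by
  have h : polyProj μ ((mulCoord μ hμ).adjoint (f - polyProj μ f)) = 0 := by
    refine polyProj_eq_zero hμ hinf fun j => ?_
    rw [ContinuousLinearMap.adjoint_inner_right, orthoPolyLp, mulCoord_polyLp]
    have hmem : polyLp hμ (X * orthoPoly μ j) ∈ polyClosure μ :=
      Submodule.le_topologicalClosure _
        (range_polyLp hμ ▸ LinearMap.mem_range_self (polyLp hμ) _)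
    exact (polyClosure μ).sub_starProjection_mem_orthogonal f _ hmem
  rw [map_sub, map_sub, sub_eq_zero] at h
  rw [hankelOp_apply, h]

theorem hankelOp_eq_zero (hμ : IsCompact μ.support) (hinf : μ.support.Infinite) {f : Lp ℂ 2 μ}
    (hf : ∀ j, inner ℂ (orthoPolyLp hμ j) f = 0) : hankelOp μ hμ f = 0 := by
  rw [hankelOp_apply, polyProj_eq_zero hμ hinf hf, map_zero, map_zero, sub_zero]

theorem norm_hankelOp_orthoPolyLp_le (hμ : IsCompact μ.support) (n j : ℕ) :
    ‖hankelOp μ hμ (orthoPolyLp hμ j)‖ ≤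
      ‖orthoRemainder (orthoPolyLp hμ) n ((mulCoord μ hμ).adjoint (orthoPolyLp hμ j))‖ := by
  have hP : polyProj μ (orthoPolyLp hμ j) = orthoPolyLp hμ j :=
    Submodule.starProjection_eq_self_iff.2 (orthoPolyLp_mem_polyClosure hμ j)
  set y := (mulCoord μ hμ).adjoint (orthoPolyLp hμ j)
  have hmem : ∑ i ∈ Finset.range (n + 1), inner ℂ (orthoPolyLp hμ i) y • orthoPolyLp hμ i ∈
      polyClosure μ :=
    Submodule.sum_mem _ fun i _ => Submodule.smul_mem _ _ (orthoPolyLp_mem_polyClosure hμ i)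
  rw [hankelOp_apply, hP]
  refine (Submodule.starProjection_minimal (U := polyClosure μ) y).trans_le ?_
  exact ciInf_le ⟨0, by rintro _ ⟨_, rfl⟩; exact norm_nonneg _⟩
    (⟨_, hmem⟩ : (polyClosure μ : Set (Lp ℂ 2 μ)))

theorem summable_norm_sq_hankelOp (hμ : IsCompact μ.support) (hinf : μ.support.Infinite) :
    Summable fun j => ‖hankelOp μ hμ (orthoPolyLp hμ j)‖ ^ 2 := by
  refine summable_of_sum_range_le (c := ‖mulCoord μ hμ‖ ^ 2) (fun j => by positivity) fun n => ?_
  calc ∑ j ∈ Finset.range n, ‖hankelOp μ hμ (orthoPolyLp hμ j)‖ ^ 2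
      ≤ ∑ j ∈ Finset.range (n + 1), ‖hankelOp μ hμ (orthoPolyLp hμ j)‖ ^ 2 :=
        Finset.sum_le_sum_of_subset_of_nonneg (Finset.range_mono n.le_succ)
          fun _ _ _ => by positivity
    _ ≤ ∑ j ∈ Finset.range (n + 1),
        ‖orthoRemainder (orthoPolyLp hμ) n ((mulCoord μ hμ).adjoint (orthoPolyLp hμ j))‖ ^ 2 := by
        gcongr with j
        exact norm_hankelOp_orthoPolyLp_le hμ n j
    _ ≤ ‖mulCoord μ hμ‖ ^ 2 :=
        sum_norm_sq_orthoRemainder_adjoint_le (orthonormal_orthoPolyLp hμ hinf) _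
          (mulCoord_orthoPolyLp_mem_span hμ hinf) (fun _ => norm_adjoint_mulCoord hμ _) n

theorem isHilbertSchmidt_hankelOp (hμ : IsCompact μ.support) (hinf : μ.support.Infinite) :
    IsHilbertSchmidt (hankelOp μ hμ) :=
  isHilbertSchmidt_of_summable (orthonormal_orthoPolyLp hμ hinf) _
    (fun _ => hankelOp_eq_zero hμ hinf) (summable_norm_sq_hankelOp hμ hinf)

/-- The kernel is the sum of `(T p_j)(z) * conj (p_j w)`, an orthogonal series in `L²(μ ⊗ μ)`. -/
theorem exists_isIntegralKernel_hankelOp (hμ : IsCompact μ.support) (hinf : μ.support.Infinite) :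
    ∃ L : Lp ℂ 2 (μ.prod μ), IsIntegralKernel μ L (hankelOp μ hμ) := by
  have he := orthonormal_orthoPolyLp hμ hinf
  obtain ⟨L, hL⟩ := ((orthogonalFamily_tensorConjLI (μ := μ) he).summable_iff_norm_sq_summable
    (fun j => hankelOp μ hμ (orthoPolyLp hμ j))).2 (summable_norm_sq_hankelOp hμ hinf)
  refine ⟨L, (isIntegralKernel_iff _ _).2 fun f g => ?_⟩
  have h1 : Tendsto (fun n => inner ℂ (tensorConj g f) (∑ j ∈ Finset.range n,
      tensorConj (hankelOp μ hμ (orthoPolyLp hμ j)) (orthoPolyLp hμ j))) atTop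
      (𝓝 (inner ℂ (tensorConj g f) L)) :=
    tendsto_const_nhds.inner hL.tendsto_sum_nat
  have h2 : Tendsto (fun n => inner ℂ g (hankelOp μ hμ (∑ j ∈ Finset.range n,
      inner ℂ (orthoPolyLp hμ j) f • orthoPolyLp hμ j))) atTop
      (𝓝 (inner ℂ g (hankelOp μ hμ (polyProj μ f)))) :=
    tendsto_const_nhds.inner
      (((hankelOp μ hμ).continuous.tendsto _).comp (tendsto_sum_polyProj hμ hinf f))
  have h3 : hankelOp μ hμ (polyProj μ f) = hankelOp μ hμ f := by
    rw [hankelOp_apply, hankelOp_apply, polyProj_polyProj]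
  rw [h3] at h2
  refine tendsto_nhds_unique h1 (h2.congr fun n => ?_)
  simp only [map_sum, map_smul, inner_sum, inner_smul_right, inner_tensorConj_tensorConj]
  exact Finset.sum_congr rfl fun j _ => mul_comm _ _

/-- The class in `L²(μ ⊗ μ)` of `z̄ K_{n+1}(z, w) - w̄ K_n(z, w)`, as a combination of elementary
tensors. -/
noncomputable def approxKernelLp (hμ : IsCompact μ.support) (n : ℕ) : Lp ℂ 2 (μ.prod μ) :=
  ∑ i ∈ Finset.range (n + 2),
      tensorConj ((mulCoord μ hμ).adjoint (orthoPolyLp hμ i)) (orthoPolyLp hμ i) -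
    ∑ j ∈ Finset.range (n + 1),
      tensorConj (orthoPolyLp hμ j) (mulCoord μ hμ (orthoPolyLp hμ j))

theorem coeFn_approxKernelLp (hμ : IsCompact μ.support) (n : ℕ) :
    approxKernelLp hμ n =ᵐ[μ.prod μ] approxKernel μ n := by
  have h1 : ∀ᵐ x ∂μ.prod μ, ∀ i : ℕ,
      tensorConj ((mulCoord μ hμ).adjoint (orthoPolyLp hμ i)) (orthoPolyLp hμ i) x =
        conj x.1 * ((orthoPoly μ i).eval x.1 * conj ((orthoPoly μ i).eval x.2)) := by
    refine ae_all_iff.2 fun i => ?_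
    filter_upwards [coeFn_tensorConj ((mulCoord μ hμ).adjoint (orthoPolyLp hμ i))
        (orthoPolyLp hμ i),
      Measure.quasiMeasurePreserving_fst.ae_eq_comp
        (coeFn_adjoint_mulCoord hμ (orthoPolyLp hμ i)),
      Measure.quasiMeasurePreserving_fst.ae_eq_comp (coeFn_orthoPolyLp hμ i),
      Measure.quasiMeasurePreserving_snd.ae_eq_comp (coeFn_orthoPolyLp hμ i)]
      with x h1 h2 h3 h4
    simp only [Function.comp_apply] at h2 h3 h4
    rw [h1, h2, h3, h4, mul_assoc]
  have h2 : ∀ᵐ x ∂μ.prod μ, ∀ j : ℕ,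
      tensorConj (orthoPolyLp hμ j) (mulCoord μ hμ (orthoPolyLp hμ j)) x =
        conj x.2 * ((orthoPoly μ j).eval x.1 * conj ((orthoPoly μ j).eval x.2)) := by
    refine ae_all_iff.2 fun j => ?_
    filter_upwards [coeFn_tensorConj (orthoPolyLp hμ j) (mulCoord μ hμ (orthoPolyLp hμ j)),
      Measure.quasiMeasurePreserving_snd.ae_eq_comp (coeFn_mulCoord hμ (orthoPolyLp hμ j)),
      Measure.quasiMeasurePreserving_fst.ae_eq_comp (coeFn_orthoPolyLp hμ j),
      Measure.quasiMeasurePreserving_snd.ae_eq_comp (coeFn_orthoPolyLp hμ j)]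
      with x h1 h2 h3 h4
    simp only [Function.comp_apply] at h2 h3 h4
    rw [h1, h2, h3, h4, map_mul]
    ring
  filter_upwards [h1, h2,
    Lp.coeFn_sub (∑ i ∈ Finset.range (n + 2),
      tensorConj ((mulCoord μ hμ).adjoint (orthoPolyLp hμ i)) (orthoPolyLp hμ i))
      (∑ j ∈ Finset.range (n + 1),
        tensorConj (orthoPolyLp hμ j) (mulCoord μ hμ (orthoPolyLp hμ j))),
    Lp.coeFn_finsetSum (Finset.range (n + 2)) (fun i =>
      tensorConj ((mulCoord μ hμ).adjoint (orthoPolyLp hμ i)) (orthoPolyLp hμ i)),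
    Lp.coeFn_finsetSum (Finset.range (n + 1)) (fun j =>
      tensorConj (orthoPolyLp hμ j) (mulCoord μ hμ (orthoPolyLp hμ j)))]
    with x h1 h2 h3 h4 h5
  rw [approxKernelLp, h3, Pi.sub_apply, h4, h5, Finset.sum_apply, Finset.sum_apply,
    Finset.sum_congr rfl fun i _ => h1 i, Finset.sum_congr rfl fun j _ => h2 j,
    ← Finset.mul_sum, ← Finset.mul_sum]
  rfl

theorem inner_tensorConj_approxKernelLp (hμ : IsCompact μ.support) (f g : Lp ℂ 2 μ) (n : ℕ) :
    inner ℂ (tensorConj g f) (approxKernelLp hμ n) =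
      inner ℂ g ((mulCoord μ hμ).adjoint
        (∑ i ∈ Finset.range (n + 2), inner ℂ (orthoPolyLp hμ i) f • orthoPolyLp hμ i) -
      ∑ j ∈ Finset.range (n + 1),
        inner ℂ (orthoPolyLp hμ j) ((mulCoord μ hμ).adjoint f) • orthoPolyLp hμ j) := by
  simp only [approxKernelLp, inner_sub_right, map_sum, map_smul, inner_sum, inner_smul_right,
    inner_tensorConj_tensorConj, ContinuousLinearMap.adjoint_inner_right, mul_comm]

/-- The approximating kernel is the kernel of `(I - P_n) M* P_{n+1}`, where `P_n` projects onto the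
polynomials of degree at most `n`: this is `M* P_{n+1} - P_n M*` because `M` raises the degree by
one. -/
theorem approxKernelLp_eq_sum (hμ : IsCompact μ.support) (hinf : μ.support.Infinite) (n : ℕ) :
    approxKernelLp hμ n = ∑ i ∈ Finset.range (n + 2),
      tensorConj (orthoRemainder (orthoPolyLp hμ) n
        ((mulCoord μ hμ).adjoint (orthoPolyLp hμ i))) (orthoPolyLp hμ i) := by
  have he := orthonormal_orthoPolyLp hμ hinf
  refine sub_eq_zero.1 (eq_zero_of_forall_inner_tensorConj _ fun g f => ?_)
  -- `M e_j` lies in the span of `e_0, …, e_{n+1}`, so pairing it with `f` sees only those terms.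
  have hexp : ∀ j ∈ Finset.range (n + 1),
      inner ℂ (orthoPolyLp hμ j) ((mulCoord μ hμ).adjoint f) =
        ∑ i ∈ Finset.range (n + 2), inner ℂ (orthoPolyLp hμ i) f *
          inner ℂ (orthoPolyLp hμ j) ((mulCoord μ hμ).adjoint (orthoPolyLp hμ i)) := by
    intro j hj
    have h0 : orthoRemainder (orthoPolyLp hμ) (n + 1) (mulCoord μ hμ (orthoPolyLp hμ j)) = 0 :=
      orthoRemainder_eq_zero he (Submodule.span_mono (Set.image_mono (Set.Iic_subset_Iic.2
        (Finset.mem_range.1 hj))) (mulCoord_orthoPolyLp_mem_span hμ hinf j))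
    rw [ContinuousLinearMap.adjoint_inner_right, sub_eq_zero.1 h0, sum_inner]
    refine Finset.sum_congr rfl fun i _ => ?_
    rw [inner_smul_left, inner_conj_symm, ContinuousLinearMap.adjoint_inner_right, mul_comm]
  rw [inner_sub_right, inner_tensorConj_approxKernelLp, sub_eq_zero, inner_sub_right, inner_sum,
    inner_sum]
  simp only [inner_tensorConj_tensorConj, orthoRemainder, inner_sub_right, sub_mul,
    Finset.sum_sub_distrib, inner_sum, inner_smul_right, map_sum, map_smul]
  congr 1
  · exact Finset.sum_congr rfl fun i _ => mul_comm _ _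
  · rw [Finset.sum_congr rfl fun j hj => by rw [hexp j hj]]
    simp only [Finset.sum_mul]
    rw [Finset.sum_comm]
    exact Finset.sum_congr rfl fun i _ => Finset.sum_congr rfl fun j _ => by ring

theorem norm_approxKernelLp_le (hμ : IsCompact μ.support) (hinf : μ.support.Infinite) (n : ℕ) :
    ‖approxKernelLp hμ n‖ ≤ √(2 * ‖mulCoord μ hμ‖ ^ 2) := by
  have he := orthonormal_orthoPolyLp hμ hinf
  refine Real.le_sqrt_of_sq_le ?_
  rw [approxKernelLp_eq_sum hμ hinf]
  refine ((orthogonalFamily_tensorConjLI (μ := μ) he).norm_sum (fun i =>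
    orthoRemainder (orthoPolyLp hμ) n ((mulCoord μ hμ).adjoint (orthoPolyLp hμ i)))
    (Finset.range (n + 2))).trans_le ?_
  exact sum_succ_norm_sq_orthoRemainder_adjoint_le he _
    (mulCoord_orthoPolyLp_mem_span hμ hinf) (fun _ => norm_adjoint_mulCoord hμ _) n

theorem tendsto_approxKernelLp (hμ : IsCompact μ.support) (hinf : μ.support.Infinite)
    {L : Lp ℂ 2 (μ.prod μ)} (hL : IsIntegralKernel μ L (hankelOp μ hμ)) :
    Tendsto (fun n => toWeakSpace ℂ (Lp ℂ 2 (μ.prod μ)) (approxKernelLp hμ n)) atTop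
      (𝓝 (toWeakSpace ℂ (Lp ℂ 2 (μ.prod μ)) L)) := by
  refine tendsto_toWeakSpace_of_dense_span (norm_approxKernelLp_le hμ hinf) _
    topologicalClosure_span_tensorConj ?_
  rintro _ ⟨g, f, rfl⟩
  rw [(isIntegralKernel_iff _ _).1 hL, hankelOp_eq_commutator hμ hinf]
  simp only [inner_tensorConj_approxKernelLp]
  refine tendsto_const_nhds.inner (Tendsto.sub ?_ ?_)
  · exact (((mulCoord μ hμ).adjoint.continuous.tendsto _).comp
      (tendsto_sum_polyProj hμ hinf f)).comp (tendsto_add_atTop_nat 2)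
  · exact (tendsto_sum_polyProj hμ hinf _).comp (tendsto_add_atTop_nat 1)

end Hankel

theorem mainTheorem5 (μ : Measure ℂ) [IsFiniteMeasure μ] (hμ : IsCompact μ.support)
    (hinf : μ.support.Infinite) :
    IsHilbertSchmidt (hankelOp μ hμ) ∧
    ∃ L : Lp ℂ 2 (μ.prod μ),
      IsIntegralKernel μ L (hankelOp μ hμ) ∧
      (∀ L' : Lp ℂ 2 (μ.prod μ), IsIntegralKernel μ L' (hankelOp μ hμ) → L' = L) ∧
      ∃ hK : ∀ n : ℕ, MemLp (approxKernel μ n) 2 (μ.prod μ),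
        Tendsto (fun n : ℕ => toWeakSpace ℂ (Lp ℂ 2 (μ.prod μ)) (hK n).toLp) atTop
          (𝓝 (toWeakSpace ℂ (Lp ℂ 2 (μ.prod μ)) L)) := by
  obtain ⟨L, hL⟩ := exists_isIntegralKernel_hankelOp hμ hinf
  have hK : ∀ n : ℕ, MemLp (approxKernel μ n) 2 (μ.prod μ) := fun n =>
    (memLp_congr_ae (coeFn_approxKernelLp hμ n)).1 (Lp.memLp _)
  refine ⟨isHilbertSchmidt_hankelOp hμ hinf, L, hL, fun L' hL' => hL'.unique hL, hK, ?_⟩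
  have h : ∀ n, (hK n).toLp = approxKernelLp hμ n := fun n =>
    Lp.ext ((hK n).coeFn_toLp.trans (coeFn_approxKernelLp hμ n).symm)
  simp only [h]
  exact tendsto_approxKernelLp hμ hinf hL
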